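/- Let $\mathcal I=[0,1)=\mathbb R/\mathbb Z$, with the distance taken mod $1$, the corresponding balls $B(c,r)$, and Lebesgue measure $\lambda$ (so $\lambda(\mathcal I)=1$). A sequence $\mathbf x=(x_n)_{n\ge1}$ in $\mathcal I$ is called Borel–Cantelli (BC) if $$\lambda\Big(\bigcap_{k\ge1}\bigcup_{n\ge k}B(x_n,a_n)\Big)=1$$ for every non-increasing sequence $(a_n)_{n\ge1}$ of positive real numbers with $a_n\to0$ and $\sum_{n\ge1}a_n=\infty$. A measure $\nu$ on $\mathcal I$ is called a weak-* limit point of $\mathbf x$ if it is a limit point (cluster point), in the weak-* topology given by integration against continuous functions on $\mathbb R/\mathbb Z$, of the sequence of measures $\frac1N\sum_{i=1}^N\delta_{x_i}$, $N=1,2,\dots$ **Proposition.** If $\mathbf x$ is a BC sequence in $\mathcal I$, then Lebesgue measure $\lambda$ is absolutely continuous with respect to every weak-* limit point $\nu$ of $\mathbf x$. -/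

import Mathlib

open MeasureTheory Filter Topology
open scoped NNReal

namespace BorelCantelliSeq

/-- A standard sequence: a non-increasing sequence of positive reals converging to `0` whose
series diverges. Sequences are indexed from `0`: `a n` is the `(n+1)`-st term. -/
structure IsStandard (a : ℕ → ℝ) : Prop where
  antitone : Antitone a
  pos : ∀ n, 0 < a n
  tendsto_zero : Tendsto a atTop (𝓝 0)
  sum_diverges : Tendsto (fun N => ∑ n ∈ Finset.range N, a n) atTop atTop

/-- A sequence in `[0,1) = ℝ/ℤ` is Borel-Cantelli if, for every standard sequence `a`, the set of
points lying in infinitely many of the balls `B(x n, a n)` (taken mod `1`) has Lebesgue measure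
`1`. Here `UnitAddCircle` is `ℝ/ℤ`, with the distance mod `1`, and `volume` on it is
Lebesgue measure, of total mass `1`. -/
def IsBC (x : ℕ → UnitAddCircle) : Prop :=
  ∀ a : ℕ → ℝ, IsStandard a →
    volume (limsup (fun n => Metric.ball (x n) (a n)) atTop) = 1

/-- The empirical measure `(1/N) ∑ δ_{x_i}` of the first `N` terms `x 0, …, x (N-1)`
(the zero measure for `N = 0`). -/
noncomputable def empiricalMeasure (x : ℕ → UnitAddCircle) (N : ℕ) :
    FiniteMeasure UnitAddCircle :=
  (N : ℝ≥0)⁻¹ • ∑ i ∈ Finset.range N, (diracProba (x i)).toFiniteMeasure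

/-- `ν` is a weak-* limit point of `x`: a cluster point of the sequence of empirical measures
in the weak topology on finite Borel measures on the compact space `ℝ/ℤ`, that is, the topology
generated by integration against continuous functions. -/
def IsWeakStarLimitPoint (x : ℕ → UnitAddCircle) (ν : FiniteMeasure UnitAddCircle) : Prop :=
  MapClusterPt ν atTop (empiricalMeasure x)

end BorelCantelliSeq

/-!
By inner regularity it suffices that a compact set `K` with `ν K = 0` is Lebesgue null.

Since `ν` charges small neighbourhoods of `K` very little, weak-* convergence along a suitable
family of times shows that for every `ε > 0` there are infinitely many `N` such that at most `ε N`
of the first `N` terms of the sequence lie within `1 / N` of `K`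
(`frequently_card_thickening_le`). Choose such times `φ 0 < φ 1 < ⋯` with `ε = 2⁻ʲ` at time
`φ j`, and let `a n = 1 / φ j` on the block `φ (j - 1) ≤ n < φ j`. This sequence is standard
(`exists_isStandard_inv_comp`): its sum diverges because the terms before `φ j` are all at least
`1 / φ j`. On the other hand, the balls of the `j`-th block that meet `K` cover at most
`2⁻ʲ φ j · (2 / φ j) = 2 · 2⁻ʲ` of it (`volume_inter_iUnion_ball_le`), which is summable. By the
Borel-Cantelli lemma almost no point of `K` is in infinitely many of the balls `B(x n, a n)`,
whereas the hypothesis says that almost every point is; hence `K` is Lebesgue null.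
-/

namespace BorelCantelliSeq

open Metric
open scoped ENNReal

/-- The empirical measure of a test function is its average along the sequence. -/
lemma testAgainstNN_empiricalMeasure (x : ℕ → UnitAddCircle) (N : ℕ)
    (f : BoundedContinuousFunction UnitAddCircle ℝ≥0) :
    (empiricalMeasure x N).testAgainstNN f = (N : ℝ≥0)⁻¹ * ∑ i ∈ Finset.range N, f (x i) := by
  rw [empiricalMeasure, FiniteMeasure.smul_testAgainstNN_apply, smul_eq_mul]
  congr 1
  rw [← ENNReal.coe_inj, FiniteMeasure.testAgainstNN_coe_eq, FiniteMeasure.toMeasure_sum,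
    lintegral_finsetSum_measure, ENNReal.ofNNReal_finsetSum]
  refine Finset.sum_congr rfl fun i _ => ?_
  exact lintegral_dirac _ _

open Classical in
/-- A `ν`-null compact set is rarely approached: for infinitely many `N`, only a small proportion
of the first `N` terms come within distance `1 / N` of it. -/
lemma frequently_card_thickening_le {x : ℕ → UnitAddCircle} {ν : FiniteMeasure UnitAddCircle}
    (hν : IsWeakStarLimitPoint x ν) {K : Set UnitAddCircle} (hK : IsCompact K)
    (hK0 : (ν : Measure UnitAddCircle) K = 0) {ε : ℝ≥0} (hε : 0 < ε) :
    ∃ᶠ N : ℕ in atTop,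
      (((Finset.range N).filter fun n => x n ∈ thickening (N : ℝ)⁻¹ K).card : ℝ≥0) ≤ ε * N := by
  obtain ⟨U, hKU, hU, hνU⟩ := K.exists_isOpen_lt_of_lt (μ := (ν : Measure UnitAddCircle)) ε
    (by rw [hK0]; exact_mod_cast hε)
  obtain ⟨δ, hδ, hδU⟩ := hK.exists_thickening_subset_open hU hKU
  have h2 : 0 < δ / 2 := by positivity
  -- The test function equals `1` on the `δ / 2`-thickening of `K` and vanishes outside `U`.
  let f := thickenedIndicator h2 (cthickening (δ / 2) K)
  have hfU : ν.testAgainstNN f < ε := by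
    rw [← ENNReal.coe_lt_coe, FiniteMeasure.testAgainstNN_coe_eq]
    refine lt_of_le_of_lt ?_ hνU
    rw [← lintegral_indicator_one hU.measurableSet]
    refine lintegral_mono fun y => ?_
    by_cases hy : y ∈ U
    · have : f y ≤ 1 := thickenedIndicator_le_one h2 _ y
      simpa [hy] using this
    · have : f y = 0 := thickenedIndicator_zero h2 _ fun h => hy <| hδU <| by
        simpa using thickening_cthickening_subset (δ / 2) h2.le K h
      simp [this]
  have hfreq : ∃ᶠ N in atTop, (empiricalMeasure x N).testAgainstNN f < ε :=
    MapClusterPt.frequently hν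
      ((FiniteMeasure.continuous_testAgainstNN_eval f).continuousAt.eventually_lt_const hfU)
  have hev : ∀ᶠ N : ℕ in atTop, (N : ℝ)⁻¹ < δ / 2 :=
    (tendsto_inv_atTop_nhds_zero_nat (𝕜 := ℝ)).eventually_lt_const h2
  refine ((hfreq.and_eventually hev).and_eventually (eventually_gt_atTop 0)).mono ?_
  rintro N ⟨⟨hN, hNδ⟩, hN0⟩
  rw [testAgainstNN_empiricalMeasure, inv_mul_lt_iff₀ (by exact_mod_cast hN0), mul_comm] at hN
  refine le_trans ?_ hN.le
  rw [Finset.natCast_card_filter]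
  refine Finset.sum_le_sum fun n _ => ?_
  split_ifs with hn
  · exact (thickenedIndicator_one h2 _
      (thickening_subset_cthickening _ _ (thickening_mono hNδ.le K hn))).ge
  · exact zero_le

/-- The standard sequence equal to `1 / φ j` on the block `φ (j - 1) ≤ n < φ j`. -/
lemma exists_isStandard_inv_comp {φ : ℕ → ℕ} (hφ : StrictMono φ) :
    ∃ k : ℕ → ℕ, (∀ n, n < φ (k n)) ∧ Tendsto k atTop atTop ∧
      IsStandard fun n => (φ (k n) : ℝ)⁻¹ := by
  have hex : ∀ n, ∃ j, n < φ j := fun n => ⟨n + 1, hφ.le_apply⟩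
  choose k hk hmin using fun n => (⟨Nat.find (hex n), Nat.find_spec (hex n),
    fun j hj => Nat.find_min' (hex n) hj⟩ : ∃ i, n < φ i ∧ ∀ j, n < φ j → i ≤ j)
  have hpos : ∀ n, (0 : ℝ) < φ (k n) := fun n => by exact_mod_cast (Nat.zero_le n).trans_lt (hk n)
  refine ⟨k, hk, ?_, ?_, fun n => inv_pos.2 (hpos n), ?_, ?_⟩
  · refine tendsto_atTop.2 fun b => (eventually_ge_atTop (φ b)).mono fun n hn => ?_
    exact (hφ.lt_iff_lt.1 (hn.trans_lt (hk n))).le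
  · intro m n hmn
    refine inv_anti₀ (hpos m) ?_
    exact_mod_cast hφ.monotone (hmin m _ (hmn.trans_lt (hk n)))
  · refine tendsto_inv_atTop_zero.comp (tendsto_natCast_atTop_atTop.comp ?_)
    exact tendsto_atTop_mono (fun n => (hk n).le) tendsto_id
  · rw [← not_summable_iff_tendsto_nat_atTop_of_nonneg fun n => (inv_pos.2 (hpos n)).le]
    intro hs
    -- A tail starting at `M` has sum at least `(φ j - M) / φ j ≥ 1 / 2` once `φ j ≥ 2 M`.
    obtain ⟨M, hM⟩ := ((tendsto_sum_nat_add fun n => (φ (k n) : ℝ)⁻¹).eventually_lt_const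
      (by norm_num : (0 : ℝ) < 1 / 2)).exists
    have hj : 2 * M + 1 ≤ φ (2 * M + 1) := hφ.le_apply
    set j := 2 * M + 1
    have hle := ((summable_nat_add_iff M).2 hs).sum_le_tsum (Finset.range (φ j - M))
      fun n _ => (inv_pos.2 (hpos (n + M))).le
    have hge : ∑ _n ∈ Finset.range (φ j - M), (φ j : ℝ)⁻¹ ≤
        ∑ n ∈ Finset.range (φ j - M), (φ (k (n + M)) : ℝ)⁻¹ := by
      refine Finset.sum_le_sum fun n hn => inv_anti₀ (hpos _) ?_
      have hn' : n + M < φ j := by have := Finset.mem_range.1 hn; omega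
      exact_mod_cast hφ.monotone (hmin _ _ hn')
    rw [Finset.sum_const, Finset.card_range, nsmul_eq_mul] at hge
    have hlt := (hge.trans hle).trans_lt hM
    rw [mul_inv_lt_iff₀ (by exact_mod_cast (by omega : 0 < φ j)),
      Nat.cast_sub (by omega)] at hlt
    have : (2 * M + 1 : ℝ) ≤ φ j := by exact_mod_cast hj
    linarith

open Classical in
/-- Only balls centred within `r` of `K` contribute to the part of `K` covered by balls of
radius `r`. -/
lemma volume_inter_iUnion_ball_le (x : ℕ → UnitAddCircle) (K : Set UnitAddCircle) (N : ℕ)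
    {r : ℝ} :
    volume (K ∩ ⋃ n ∈ Finset.range N, ball (x n) r) ≤
      ((Finset.range N).filter fun n => x n ∈ thickening r K).card * ENNReal.ofReal (2 * r) := by
  have hsub : K ∩ ⋃ n ∈ Finset.range N, ball (x n) r ⊆
      ⋃ n ∈ (Finset.range N).filter fun n => x n ∈ thickening r K, ball (x n) r := by
    rintro y ⟨hyK, hy⟩
    simp only [Set.mem_iUnion, exists_prop] at hy
    obtain ⟨n, hn, hny⟩ := hy
    refine Set.mem_biUnion (Finset.mem_filter.2 ⟨hn, mem_thickening_iff.2 ⟨y, hyK, ?_⟩⟩) hny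
    rwa [dist_comm]
  refine (measure_mono hsub).trans <| (measure_biUnion_finset_le _ _).trans ?_
  refine (Finset.sum_le_card_nsmul _ _ (ENNReal.ofReal (2 * r)) fun n _ => ?_).trans_eq
    (nsmul_eq_mul _ _)
  refine (measure_mono ball_subset_closedBall).trans ?_
  rw [AddCircle.volume_closedBall]
  exact ENNReal.ofReal_le_ofReal (min_le_right _ _)

/-- For a Borel-Cantelli sequence, a compact set null for a weak-* limit point is
Lebesgue null. -/
lemma volume_eq_zero_of_isCompact {x : ℕ → UnitAddCircle} (hx : IsBC x)
    {ν : FiniteMeasure UnitAddCircle} (hν : IsWeakStarLimitPoint x ν)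
    {K : Set UnitAddCircle} (hK : IsCompact K) (hK0 : (ν : Measure UnitAddCircle) K = 0) :
    volume K = 0 := by
  classical
  obtain ⟨φ, hφ, hcard⟩ := extraction_forall_of_frequently fun j : ℕ =>
    (frequently_card_thickening_le hν hK hK0 (ε := (1 / 2) ^ j) (by positivity)).and_eventually
      (eventually_gt_atTop 0)
  obtain ⟨k, hk, hktop, hstd⟩ := exists_isStandard_inv_comp hφ
  have hfull := hx _ hstd
  set L := limsup (fun n => ball (x n) (φ (k n) : ℝ)⁻¹) atTop with hL
  let A : ℕ → Set UnitAddCircle := fun j => K ∩ ⋃ n ∈ Finset.range (φ j), ball (x n) (φ j : ℝ)⁻¹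
  have hA : ∀ j, volume (A j) ≤ 2 * (1 / 2 : ℝ≥0∞) ^ j := by
    intro j
    obtain ⟨hj, hj0⟩ := hcard j
    have hj0' : (φ j : ℝ≥0) ≠ 0 := by exact_mod_cast hj0.ne'
    refine (volume_inter_iUnion_ball_le x K (φ j)).trans ?_
    have h2 : ENNReal.ofReal (2 * (φ j : ℝ)⁻¹) = ((2 * (φ j : ℝ≥0)⁻¹ : ℝ≥0) : ℝ≥0∞) := by
      rw [← ENNReal.ofReal_coe_nnreal]; simp
    have h3 : 2 * (1 / 2 : ℝ≥0∞) ^ j = ((2 * (1 / 2) ^ j : ℝ≥0) : ℝ≥0∞) := by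
      push_cast; simp
    rw [h2, h3, ← ENNReal.coe_natCast, ← ENNReal.coe_mul, ENNReal.coe_le_coe]
    refine (mul_le_mul_left hj _).trans_eq ?_
    field_simp
  have hsum : ∑' j, volume (A j) ≠ ∞ := by
    refine ne_top_of_le_ne_top ?_ (ENNReal.tsum_le_tsum hA)
    rw [ENNReal.tsum_mul_left, ENNReal.tsum_geometric]
    simp [ENNReal.mul_eq_top]
  have hAlim : volume (limsup A atTop) = 0 := measure_limsup_atTop_eq_zero hsum
  have hKL : K ⊆ limsup A atTop ∪ Lᶜ := by
    intro y hy
    by_cases hyL : y ∈ L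
    · left
      rw [hL, mem_limsup_iff_frequently_mem] at hyL
      rw [mem_limsup_iff_frequently_mem]
      exact hktop.frequently <| hyL.mono fun n hn =>
        ⟨hy, Set.mem_biUnion (Finset.mem_coe.2 <| Finset.mem_range.2 (hk n)) hn⟩
    · exact Or.inr hyL
  have hLm : MeasurableSet L := MeasurableSet.measurableSet_limsup fun n => measurableSet_ball
  have hLc : volume Lᶜ = 0 := by
    rw [measure_compl hLm (measure_ne_top _ _), hfull, UnitAddCircle.measure_univ, tsub_self]
  exact measure_mono_null hKL (measure_union_null hAlim hLc)

end BorelCantelliSeq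

theorem mainTheorem12 (x : ℕ → UnitAddCircle) (hx : BorelCantelliSeq.IsBC x)
    (ν : MeasureTheory.FiniteMeasure UnitAddCircle)
    (hν : BorelCantelliSeq.IsWeakStarLimitPoint x ν) :
    (MeasureTheory.volume : MeasureTheory.Measure UnitAddCircle) ≪
      (ν : MeasureTheory.Measure UnitAddCircle) := by
  refine Measure.AbsolutelyContinuous.mk fun s hs hs0 => ?_
  by_contra hne
  obtain ⟨K, hKs, hK, hKpos⟩ := hs.exists_lt_isCompact (pos_iff_ne_zero.2 hne)
  exact hKpos.ne'
    (BorelCantelliSeq.volume_eq_zero_of_isCompact hx hν hK (measure_mono_null hKs hs0))
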